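/- Let $E/F$ be a finite field extension with $n=[E:F]$, and let $v:F\to\Gamma\cup\{\infty\}$ be a valuation, $\Gamma$ a totally ordered abelian group, with value group $\Gamma_v=v(F\setminus\{0\})$ and divisible hull $\Gamma_{\mathrm{div}}$ of $\Gamma_v$. An *exponential quasi-valuation on $E$ extending $v$* is a map $w:E\to M\cup\{\infty\}$, where $M$ is a totally ordered abelian monoid containing $\Gamma_v$ as an ordered submonoid and $\infty$ is greater than all elements of $M$, such that $w(0)=\infty$, $w(xy)\ge w(x)+w(y)$, $w(x+y)\ge\min\{w(x),w(y)\}$ and $w(x^k)=k\,w(x)$ for all $x,y\in E$ and all integers $k\ge1$, such that $w|_F=v$, and such that the value monoid $M_w$ (the submonoid of $M$ generated by $w(E\setminus\{0\})$) is weakly cancellative: $a+b=a$ implies $b=0$ for $a,b\in M_w$. Two of them, $w$ and $w'$, are identified if $w'=e\circ w$ on $E\setminus\{0\}$ for an isomorphism of ordered monoids $e:M_w\to M_{w'}$. Extensions of $v$ to a valuation on $E$ are taken with values in $\Gamma_{\mathrm{div}}\cup\{\infty\}$ and restrict to $v$ on $F$. Then: 1. $v$ has at most $n$ extensions to a valuation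 on $E$. 2. There is an injective map that sends each exponential quasi-valuation $w$ on $E$ extending $v$ (up to the identification above) to a nonempty set $\{u_1,\dots,u_k\}$ of extensions of $v$ to a valuation on $E$, such that, for some embedding of ordered monoids $M_w\hookrightarrow\Gamma_{\mathrm{div}}$ over $\Gamma_v$, $w(x)=\min\{u_1(x),\dots,u_k(x)\}$ for every $x\in E$. 3. Consequently there are, up to the identification above, at most $\sum_{i=1}^{n}\binom ni=2^n-1$ exponential quasi-valuations on $E$ extending $v$. -/

import Mathlib

universe uM uF uE uΓ

/-- A quasi-valuation on a ring `R` with values in a totally ordered abelian monoid `M` with an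
element `∞` (here `⊤`) adjoined on top: `w 0 = ∞`, `w (x y) ≥ w x + w y` and
`w (x + y) ≥ min (w x) (w y)`. -/
structure IsQuasiValuation {R M : Type*} [Ring R] [AddCommMonoid M] [LinearOrder M]
    (w : R → WithTop M) : Prop where
  map_zero : w 0 = ⊤
  add_le_map_mul : ∀ x y : R, w x + w y ≤ w (x * y)
  min_le_map_add : ∀ x y : R, min (w x) (w y) ≤ w (x + y)

/-- An exponential quasi-valuation: moreover `w (x ^ k) = k • w x` for all `x` and all `k ≥ 1`. -/
structure IsExponentialQuasiValuation {R M : Type*} [Ring R] [AddCommMonoid M] [LinearOrder M]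
    (w : R → WithTop M) : Prop extends IsQuasiValuation w where
  map_pow : ∀ (x : R) (k : ℕ), 0 < k → w (x ^ k) = k • w x

/-- The value monoid `M_w`: the submonoid of `M` generated by `w (R \ {0})`. -/
def valueMonoid {R M : Type*} [Ring R] [AddCommMonoid M] (w : R → WithTop M) : AddSubmonoid M :=
  AddSubmonoid.closure {m : M | ∃ x : R, x ≠ 0 ∧ w x = (m : WithTop M)}

/-- An additive monoid is weakly cancellative if `a + b = a` implies `b = 0`. -/
def IsWeaklyCancellative (M : Type*) [AddMonoid M] : Prop :=
  ∀ a b : M, a + b = a → b = 0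

/-- The value group `Γ_v` of a valuation `v : F → Γ ∪ {∞}`: the subgroup of the finite values
of `v`. -/
def valueGroup {F Γ : Type*} [Field F] [AddCommGroup Γ] [LinearOrder Γ] [IsOrderedAddMonoid Γ]
    (v : AddValuation F (WithTop Γ)) : AddSubgroup Γ where
  carrier := {γ : Γ | ∃ a : F, v a = (γ : WithTop Γ)}
  zero_mem' := ⟨1, by simp⟩
  add_mem' := by
    rintro γ δ ⟨a, ha⟩ ⟨b, hb⟩
    exact ⟨a * b, by rw [v.map_mul, ha, hb, WithTop.coe_add]⟩
  neg_mem' := by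
    rintro γ ⟨a, ha⟩
    have ha0 : a ≠ 0 := by
      rintro rfl
      simp at ha
    refine ⟨a⁻¹, ?_⟩
    have h : v a⁻¹ + v a = 0 := by rw [← v.map_mul, inv_mul_cancel₀ ha0, v.map_one]
    rw [ha] at h
    generalize v a⁻¹ = t at h
    induction t using WithTop.recTopCoe with
    | top => simp at h
    | coe t =>
      have h' : t + γ = 0 := by exact_mod_cast h
      rw [eq_neg_of_add_eq_zero_left h']

/-- `w` extends `v`, where `Γ_v` is regarded as a part of `M` through `ι`: `w a = v a` for every
nonzero `a` in `F`. -/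
def ExtendsAlong {F E Γ M : Type*} [Field F] [Field E] [Algebra F E]
    [AddCommGroup Γ] [LinearOrder Γ] [IsOrderedAddMonoid Γ]
    (v : AddValuation F (WithTop Γ)) (ι : valueGroup v → M) (w : E → WithTop M) : Prop :=
  ∀ (a : F) (γ : valueGroup v), v a = ((γ : Γ) : WithTop Γ) →
    w (algebraMap F E a) = (ι γ : WithTop M)

/-- An exponential quasi-valuation on `E` extending `v`, with weakly cancellative value monoid.
The totally ordered abelian monoid `M` of values is arbitrary and contains `Γ_v` as an ordered
submonoid through `incl`. -/
structure ExpQuasiValExt {F : Type uF} (E : Type uE) {Γ : Type uΓ}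
    [Field F] [Field E] [Algebra F E]
    [AddCommGroup Γ] [LinearOrder Γ] [IsOrderedAddMonoid Γ]
    (v : AddValuation F (WithTop Γ)) : Type (max (uM + 1) uE uΓ) where
  M : Type uM
  [addCommMonoid : AddCommMonoid M]
  [linearOrder : LinearOrder M]
  [isOrderedAddMonoid : IsOrderedAddMonoid M]
  incl : valueGroup v →+ M
  incl_strictMono : StrictMono incl
  w : E → WithTop M
  isExponential : IsExponentialQuasiValuation w
  extendsAlong : ExtendsAlong v incl w
  weaklyCancellative : IsWeaklyCancellative (valueMonoid w)

attribute [instance] ExpQuasiValExt.addCommMonoid ExpQuasiValExt.linearOrder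
  ExpQuasiValExt.isOrderedAddMonoid

/-- Identification of exponential quasi-valuations extending `v`: there is an isomorphism of
ordered monoids `e : M_w ≃ M_w'` with `w' = e ∘ w` (it is then automatically the identity on
`Γ_v`, as `w` and `w'` both restrict to `v`). -/
def ExpQuasiValExt.Iso {F : Type uF} {E : Type uE} {Γ : Type uΓ}
    [Field F] [Field E] [Algebra F E]
    [AddCommGroup Γ] [LinearOrder Γ] [IsOrderedAddMonoid Γ]
    {v : AddValuation F (WithTop Γ)} (A B : ExpQuasiValExt.{uM} E v) : Prop :=
  ∃ e : valueMonoid A.w ≃+o valueMonoid B.w, ∀ (x : E) (m : valueMonoid A.w),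
    A.w x = ((m : A.M) : WithTop A.M) → B.w x = ((e m : B.M) : WithTop B.M)

theorem ExpQuasiValExt.exists_coe {F : Type uF} {E : Type uE} {Γ : Type uΓ}
    [Field F] [Field E] [Algebra F E]
    [AddCommGroup Γ] [LinearOrder Γ] [IsOrderedAddMonoid Γ]
    {v : AddValuation F (WithTop Γ)} (A : ExpQuasiValExt.{uM} E v) {x : E} (hx : x ≠ 0) :
    ∃ m : valueMonoid A.w, A.w x = ((m : A.M) : WithTop A.M) := by
  have h1 : A.w 1 = ((A.incl 0 : A.M) : WithTop A.M) := by
    have := A.extendsAlong 1 0 (by simp)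
    simpa using this
  have hle := A.isExponential.add_le_map_mul x x⁻¹
  rw [mul_inv_cancel₀ hx, h1] at hle
  obtain ⟨m, hm⟩ : ∃ m : A.M, A.w x = (m : WithTop A.M) := by
    cases h : A.w x with
    | top => rw [h] at hle; simp at hle
    | coe m => exact ⟨m, rfl⟩
  exact ⟨⟨m, AddSubmonoid.subset_closure ⟨x, hx, hm⟩⟩, hm⟩

/-- Exponential quasi-valuations extending `v`, up to identification. -/
instance ExpQuasiValExt.setoid {F : Type uF} (E : Type uE) {Γ : Type uΓ}
    [Field F] [Field E] [Algebra F E]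
    [AddCommGroup Γ] [LinearOrder Γ] [IsOrderedAddMonoid Γ]
    (v : AddValuation F (WithTop Γ)) : Setoid (ExpQuasiValExt.{uM} E v) where
  r := ExpQuasiValExt.Iso
  iseqv :=
    { refl := fun A => ⟨OrderAddMonoidIso.refl _, fun _ _ h => h⟩
      symm := by
        rintro A B ⟨e, he⟩
        refine ⟨e.symm, fun x m hm => ?_⟩
        have hx : x ≠ 0 := by
          rintro rfl
          rw [B.isExponential.map_zero] at hm
          exact WithTop.top_ne_coe hm
        obtain ⟨k, hk⟩ := A.exists_coe hx
        have h := he x k hk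
        rw [hm, WithTop.coe_inj] at h
        have hmk : m = e k := Subtype.ext h
        rw [hmk, hk]
        simp
      trans := by
        rintro A B C ⟨e, he⟩ ⟨f, hf⟩
        exact ⟨e.trans f, fun x m hm => hf x (e m) (he x m hm)⟩ }

/-- The divisible hull of the value group of `v`. -/
abbrev GammaDiv {F Γ : Type*} [Field F] [AddCommGroup Γ] [LinearOrder Γ] [IsOrderedAddMonoid Γ]
    (v : AddValuation F (WithTop Γ)) : Type _ :=
  DivisibleHull (valueGroup v)

/-- The valuations on `E` extending `v`, with values in the divisible hull of `Γ_v` (in which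
the value group of every extension of `v` to an algebraic extension embeds uniquely over
`Γ_v`). -/
def valuationExtensions {F : Type*} (E : Type*) {Γ : Type*} [Field F] [Field E] [Algebra F E]
    [AddCommGroup Γ] [LinearOrder Γ] [IsOrderedAddMonoid Γ]
    (v : AddValuation F (WithTop Γ)) : Set (AddValuation E (WithTop (GammaDiv v))) :=
  {u | ExtendsAlong v (DivisibleHull.coeOrderAddMonoidHom (valueGroup v)) u}

/-- `w = min S` for a set `S` of valuations with values in the divisible hull of `Γ_v`, where
`M_w` is regarded as a part of the divisible hull through an embedding `j` of ordered monoids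
which is the identity on `Γ_v`. -/
def ExpQuasiValExt.IsMinOf {F : Type uF} {E : Type uE} {Γ : Type uΓ}
    [Field F] [Field E] [Algebra F E]
    [AddCommGroup Γ] [LinearOrder Γ] [IsOrderedAddMonoid Γ]
    {v : AddValuation F (WithTop Γ)} (A : ExpQuasiValExt.{uM} E v)
    (S : Set (AddValuation E (WithTop (GammaDiv v)))) : Prop :=
  ∃ j : valueMonoid A.w →+ GammaDiv v, StrictMono j ∧
    (∀ (γ : valueGroup v) (m : valueMonoid A.w), (m : A.M) = A.incl γ →
      j m = DivisibleHull.coeOrderAddMonoidHom (valueGroup v) γ) ∧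
    ∀ (x : E) (m : valueMonoid A.w), A.w x = ((m : A.M) : WithTop A.M) →
      IsLeast ((fun u : AddValuation E (WithTop (GammaDiv v)) => u x) '' S)
        ((j m : GammaDiv v) : WithTop (GammaDiv v))

/-! ### Sums of elements with distinct values -/

namespace IsQuasiValuation

variable {R M : Type*} [Ring R] [AddCommMonoid M] [LinearOrder M] {w : R → WithTop M}

theorem map_add_eq_of_lt (hw : IsQuasiValuation w) (hneg : ∀ x, w (-x) = w x) {x y : R}
    (h : w x < w y) : w (x + y) = w x := by
  refine le_antisymm ?_ ((le_min le_rfl h.le).trans (hw.min_le_map_add x y))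
  have := hw.min_le_map_add (x + y) (-y)
  rw [hneg, add_neg_cancel_right] at this
  rcases min_le_iff.mp this with h' | h'
  · exact h'
  · exact absurd h (not_lt.mpr h')

theorem map_add_of_ne (hw : IsQuasiValuation w) (hneg : ∀ x, w (-x) = w x) {x y : R}
    (h : w x ≠ w y) : w (x + y) = w x ∨ w (x + y) = w y := by
  rcases h.lt_or_gt with h | h
  · exact Or.inl (hw.map_add_eq_of_lt hneg h)
  · rw [add_comm]
    exact Or.inr (hw.map_add_eq_of_lt hneg h)

/-- The value of a sum of elements with pairwise distinct values is the value of a summand. -/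
theorem exists_map_sum_eq (hw : IsQuasiValuation w) (hneg : ∀ x, w (-x) = w x) {ι : Type*}
    (f : ι → R) {s : Finset ι} (hs : s.Nonempty) (hf : Set.InjOn (fun i => w (f i)) s) :
    ∃ i ∈ s, w (∑ i ∈ s, f i) = w (f i) := by
  classical
  induction hs using Finset.Nonempty.cons_induction with
  | singleton a => exact ⟨a, by simp⟩
  | cons a s ha hs ih =>
    obtain ⟨i, hi, h⟩ := ih (hf.mono (by simp))
    rw [Finset.sum_cons]
    have hne : w (f a) ≠ w (∑ i ∈ s, f i) := by
      rw [h]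
      intro h'
      exact ha (hf (by simp) (by simp [hi]) h' ▸ hi)
    rcases hw.map_add_of_ne hneg hne with h' | h'
    · exact ⟨a, by simp, h'⟩
    · exact ⟨i, by simp [hi], h'.trans h⟩

end IsQuasiValuation

/-! ### Embedding the value monoid in the divisible hull -/

theorem IsAddUnit.add_lt_add_left' {M : Type*} [AddCommMonoid M] [LinearOrder M]
    [IsOrderedAddMonoid M] {a b c : M} (ha : IsAddUnit a) (h : b < c) : a + b < a + c :=
  lt_of_le_of_ne (add_le_add_right h.le a) fun h' => h.ne (ha.add_left_cancel h')

theorem IsAddUnit.nsmul_lt_nsmul {M : Type*} [AddCommMonoid M] [LinearOrder M]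
    [IsOrderedAddMonoid M] {a b : M} (ha : IsAddUnit a) (h : a < b) {n : ℕ} (hn : 0 < n) :
    n • a < n • b := by
  obtain ⟨n, rfl⟩ := Nat.exists_eq_succ_of_ne_zero hn.ne'
  rw [succ_nsmul, succ_nsmul]
  exact ((ha.nsmul n).add_lt_add_left' h).trans_le
    (add_le_add_left (nsmul_le_nsmul_right h.le n) b)

section

variable {F : Type uF} {E : Type uE} {Γ : Type uΓ} [Field F] [Field E] [Algebra F E]
    [AddCommGroup Γ] [LinearOrder Γ] [IsOrderedAddMonoid Γ]
    {v : AddValuation F (WithTop Γ)}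

theorem valueGroup.exists_map_eq (γ : valueGroup v) :
    ∃ a : F, a ≠ 0 ∧ v a = ((γ : Γ) : WithTop Γ) := by
  obtain ⟨a, ha⟩ := γ.2
  refine ⟨a, ?_, ha⟩
  rintro rfl
  simp at ha

theorem exists_valueGroup_eq (v : AddValuation F (WithTop Γ)) {a : F} (ha : a ≠ 0) :
    ∃ γ : valueGroup v, v a = ((γ : Γ) : WithTop Γ) := by
  obtain ⟨γ, hγ⟩ := WithTop.ne_top_iff_exists.mp (v.ne_top_iff.mpr ha)
  exact ⟨⟨γ, a, hγ.symm⟩, hγ.symm⟩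

namespace ExpQuasiValExt

variable (A : ExpQuasiValExt.{uM} E v)

theorem w_one : A.w 1 = 0 := by
  have := A.extendsAlong 1 0 (by simp)
  simpa using this

/-- The missing inequality is the product axiom applied to `a⁻¹` and `a x`, as `w(a⁻¹) = -w(a)` in
`Γ_v`. -/
theorem map_algebraMap_mul (a : F) (x : E) :
    A.w (algebraMap F E a * x) = A.w (algebraMap F E a) + A.w x := by
  refine le_antisymm ?_ (A.isExponential.add_le_map_mul _ _)
  by_cases ha : a = 0
  · simp [ha, A.isExponential.map_zero]
  obtain ⟨γ, hγ⟩ := exists_valueGroup_eq v ha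
  have h1 := A.extendsAlong a γ hγ
  have h2 := A.extendsAlong a⁻¹ (-γ) (by simp [hγ])
  have h3 := A.isExponential.add_le_map_mul (algebraMap F E a⁻¹) (algebraMap F E a * x)
  rw [← mul_assoc, ← map_mul, inv_mul_cancel₀ ha, map_one, one_mul] at h3
  refine le_trans (le_of_eq ?_) (add_le_add_right h3 _)
  rw [← add_assoc, h1, h2, ← WithTop.coe_add, ← map_add]
  simp

theorem map_neg (x : E) : A.w (-x) = A.w x := by
  have h := A.map_algebraMap_mul (-1) x
  rwa [A.extendsAlong (-1) 0 (by simp), _root_.map_neg, map_one, neg_one_mul, map_zero,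
    WithTop.coe_zero, zero_add] at h

theorem incl_mem_valueMonoid (γ : valueGroup v) : A.incl γ ∈ valueMonoid A.w := by
  obtain ⟨a, ha, h⟩ := valueGroup.exists_map_eq γ
  exact AddSubmonoid.subset_closure ⟨algebraMap F E a, by simpa using ha, A.extendsAlong a γ h⟩

theorem ne_zero_of_map_eq_coe {x : E} {m : A.M} (hm : A.w x = (m : WithTop A.M)) : x ≠ 0 := by
  rintro rfl
  rw [A.isExponential.map_zero] at hm
  exact WithTop.top_ne_coe hm

theorem exists_nsmul_eq_incl_of_map_eq [Algebra.IsAlgebraic F E] {x : E} {m : A.M}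
    (hm : A.w x = (m : WithTop A.M)) :
    ∃ (k : ℕ+) (γ : valueGroup v), (k : ℕ) • m = A.incl γ := by
  have hx : x ≠ 0 := A.ne_zero_of_map_eq_coe hm
  have hmem : m ∈ valueMonoid A.w := AddSubmonoid.subset_closure ⟨x, hx, hm⟩
  obtain ⟨p, hp, hpx⟩ := Algebra.IsAlgebraic.isAlgebraic (R := F) x
  have hterm (i : ℕ) : A.w (algebraMap F E (p.coeff i) * x ^ i) =
      A.w (algebraMap F E (p.coeff i)) + ((i • m : A.M) : WithTop A.M) := by
    rw [A.map_algebraMap_mul]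
    congr 1
    rcases Nat.eq_zero_or_pos i with rfl | hi
    · simp [A.w_one]
    · rw [A.isExponential.map_pow x i hi, hm, WithTop.coe_nsmul]
  -- With distinct values, `w(0) = ∞` would be the value of a term with nonzero coefficient, which
  -- is finite.
  have hnot : ¬ Set.InjOn (fun i => A.w (algebraMap F E (p.coeff i) * x ^ i)) p.support := by
    intro hinj
    obtain ⟨i, hi, h⟩ := A.isExponential.exists_map_sum_eq A.map_neg _
      (Polynomial.support_nonempty.mpr hp) hinj
    rw [Polynomial.aeval_eq_sum_range' (Nat.lt_succ_self _)] at hpx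
    have hsum : ∑ i ∈ p.support, algebraMap F E (p.coeff i) * x ^ i = 0 := by
      rw [← hpx]
      refine Finset.sum_subset_zero_on_sdiff ?_ ?_ ?_
      · exact Polynomial.supp_subset_range (Nat.lt_succ_self _)
      · intro j hj
        have : p.coeff j = 0 := by simpa using (Finset.mem_sdiff.mp hj).2
        simp [this]
      · intro j _
        rw [Algebra.smul_def]
    obtain ⟨γ, hγ⟩ := exists_valueGroup_eq v (Polynomial.mem_support_iff.mp hi)
    rw [hsum, hterm, A.extendsAlong _ γ hγ, A.isExponential.map_zero] at h
    exact WithTop.top_ne_coe (h.trans (WithTop.coe_add _ _).symm)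
  obtain ⟨i, hi, j, hj, hij, hlt⟩ : ∃ i ∈ p.support, ∃ j ∈ p.support,
      A.w (algebraMap F E (p.coeff i) * x ^ i) = A.w (algebraMap F E (p.coeff j) * x ^ j) ∧
        i < j := by
    simp only [Set.InjOn, not_forall] at hnot
    obtain ⟨i, hi, j, hj, h, hne⟩ := hnot
    rcases Nat.lt_or_gt_of_ne hne with hl | hl
    · exact ⟨i, hi, j, hj, h, hl⟩
    · exact ⟨j, hj, i, hi, h.symm, hl⟩
  obtain ⟨γ, hγ⟩ := exists_valueGroup_eq v (Polynomial.mem_support_iff.mp hi)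
  obtain ⟨δ, hδ⟩ := exists_valueGroup_eq v (Polynomial.mem_support_iff.mp hj)
  rw [hterm, hterm, A.extendsAlong _ γ hγ, A.extendsAlong _ δ hδ, ← WithTop.coe_add,
    ← WithTop.coe_add, WithTop.coe_inj] at hij
  obtain ⟨k, rfl⟩ := Nat.exists_eq_add_of_lt hlt
  refine ⟨⟨k + 1, k.succ_pos⟩, γ - δ, ?_⟩
  -- The equality of values is `γ + i m = δ + (i + k + 1) m`. Only weak cancellation is available,
  -- so it is rewritten as `i m + b = i m`.
  have key : i • m + (A.incl (δ - γ) + (k + 1) • m) = i • m := by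
    have h1 : A.incl (-γ) + A.incl γ = 0 := by rw [← map_add]; simp
    calc i • m + (A.incl (δ - γ) + (k + 1) • m)
        = A.incl (-γ) + (A.incl δ + (i + k + 1) • m) := by
          rw [sub_eq_neg_add, map_add, Nat.add_assoc i, add_nsmul m i]
          ac_rfl
      _ = i • m := by rw [← hij, ← add_assoc, h1, zero_add]
  have hz := A.weaklyCancellative ⟨i • m, AddSubmonoid.nsmul_mem _ hmem _⟩
    ⟨A.incl (δ - γ) + (k + 1) • m, AddSubmonoid.add_mem _ (A.incl_mem_valueMonoid _)
      (AddSubmonoid.nsmul_mem _ hmem _)⟩ (Subtype.ext key)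
  have hz' : A.incl (δ - γ) + (k + 1) • m = 0 := congrArg Subtype.val hz
  have h1 : A.incl (γ - δ) + A.incl (δ - γ) = 0 := by rw [← map_add]; simp
  calc (k + 1) • m = A.incl (γ - δ) + A.incl (δ - γ) + (k + 1) • m := by rw [h1, zero_add]
    _ = A.incl (γ - δ) := by rw [add_assoc, hz', add_zero]

theorem exists_nsmul_eq_incl [Algebra.IsAlgebraic F E] (m : valueMonoid A.w) :
    ∃ (k : ℕ+) (γ : valueGroup v), (k : ℕ) • (m : A.M) = A.incl γ := by
  obtain ⟨m, hm⟩ := m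
  induction hm using AddSubmonoid.closure_induction with
  | mem m h =>
    obtain ⟨x, -, hx⟩ := h
    exact A.exists_nsmul_eq_incl_of_map_eq hx
  | zero => exact ⟨1, 0, by simp⟩
  | add a b _ _ iha ihb =>
    obtain ⟨k, γ, hk⟩ := iha
    obtain ⟨l, δ, hl⟩ := ihb
    refine ⟨k * l, (l : ℕ) • γ + (k : ℕ) • δ, ?_⟩
    simp only at hk hl
    simp only [PNat.mul_coe, map_add, map_nsmul, ← hk, ← hl, nsmul_add, mul_nsmul]
    rw [← mul_nsmul b, ← mul_nsmul b, mul_comm]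

/-- A positive multiple of `m` lies in a group. Invertibility replaces cancellation in `M` when
strict inequalities are multiplied by integers. -/
theorem isAddUnit [Algebra.IsAlgebraic F E] (m : valueMonoid A.w) : IsAddUnit (m : A.M) := by
  obtain ⟨k, γ, h⟩ := A.exists_nsmul_eq_incl m
  rw [← isAddUnit_nsmul_iff k.ne_zero, h]
  exact IsAddUnit.of_add_eq_zero (A.incl (-γ)) (by rw [← map_add]; simp)

/-- The value monoid of an exponential quasi-valuation extending `v` embeds into the divisible
hull of the value group of `v`. -/
theorem exists_embedding [Algebra.IsAlgebraic F E] :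
    ∃ j : valueMonoid A.w →+ GammaDiv v, StrictMono j ∧
      ∀ (m : valueMonoid A.w) (k : ℕ+) (γ : valueGroup v),
        (k : ℕ) • (m : A.M) = A.incl γ → j m = DivisibleHull.mk γ k := by
  choose k γ h using A.exists_nsmul_eq_incl
  have huniq (m : valueMonoid A.w) (l : ℕ+) (δ : valueGroup v)
      (hl : (l : ℕ) • (m : A.M) = A.incl δ) :
      DivisibleHull.mk (γ m) (k m) = DivisibleHull.mk δ l := by
    rw [DivisibleHull.mk_eq_mk_iff_smul_eq_smul]
    apply A.incl_strictMono.injective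
    rw [map_nsmul, map_nsmul, ← h, ← hl, ← mul_nsmul, ← mul_nsmul, mul_comm]
  refine ⟨⟨⟨fun m => DivisibleHull.mk (γ m) (k m), ?_⟩, ?_⟩, ?_, huniq⟩
  · rw [huniq 0 1 0 (by simp)]
    simp
  · intro a b
    change _ = DivisibleHull.mk (γ a) (k a) + DivisibleHull.mk (γ b) (k b)
    rw [DivisibleHull.mk_add_mk]
    refine huniq _ _ _ ?_
    simp only [PNat.mul_coe, map_add, map_nsmul, ← h, AddSubmonoid.coe_add, nsmul_add,
      ← mul_nsmul]
    rw [mul_comm]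
  · intro a b hab
    change DivisibleHull.mk (γ a) (k a) < DivisibleHull.mk (γ b) (k b)
    rw [DivisibleHull.mk_lt_mk, ← A.incl_strictMono.lt_iff_lt, map_nsmul, map_nsmul, ← h, ← h,
      ← mul_nsmul, ← mul_nsmul, mul_comm]
    exact (A.isAddUnit a).nsmul_lt_nsmul hab (Nat.mul_pos (k b).pos (k a).pos)

end ExpQuasiValExt
end

/-! ### Finitely many valuations and linear independence -/

theorem nsmul_lt_nsmul_left_of_neg {G : Type*} [AddCommGroup G] [LinearOrder G]
    [IsOrderedAddMonoid G] {g : G} (hg : g < 0) {m n : ℕ} (h : m < n) : n • g < m • g := by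
  have := nsmul_lt_nsmul_left (neg_pos.mpr hg) h
  rwa [neg_nsmul, neg_nsmul, neg_lt_neg_iff] at this

namespace AddValuation

variable {K G : Type*} [Field K] [AddCommGroup G] [LinearOrder G] [IsOrderedAddMonoid G]

open Polynomial

theorem zero_le_map_intCast (u : AddValuation K (WithTop G)) (n : ℤ) : 0 ≤ u (n : K) := by
  induction n using Int.induction_on with
  | zero => simp
  | succ n ih =>
    push_cast at ih ⊢
    exact u.map_le_add ih (by simp)
  | pred n ih =>
    push_cast at ih ⊢
    exact u.map_le_sub ih (by simp)

theorem zero_le_map_aeval (u : AddValuation K (WithTop G)) {y : K} (hy : 0 ≤ u y) (p : ℤ[X]) :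
    0 ≤ u (aeval y p) := by
  rw [aeval_eq_sum_range]
  refine u.map_le_sum fun i _ => ?_
  rw [zsmul_eq_mul, u.map_mul, u.map_pow]
  exact add_nonneg (u.zero_le_map_intCast _) (nsmul_nonneg hy i)

/-- Integer coefficients have value at least `0`, so for `u y < 0` the leading term alone has the
least value. -/
theorem map_aeval_of_monic (u : AddValuation K (WithTop G)) {y : K} (hy : u y < 0) {p : ℤ[X]}
    (hp : p.Monic) : u (aeval y p) = p.natDegree • u y := by
  obtain ⟨g, hg⟩ := WithTop.ne_top_iff_exists.mp (hy.trans_le le_top).ne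
  have hg0 : g < 0 := by rw [← hg] at hy; exact_mod_cast hy
  conv_lhs => rw [hp.as_sum]
  rw [_root_.map_add (aeval y), map_sum]
  have h1 : u (aeval y (X ^ p.natDegree : ℤ[X])) = p.natDegree • u y := by simp
  rw [u.map_add_eq_of_lt_left, h1]
  rw [h1, ← hg, ← WithTop.coe_nsmul]
  refine u.map_lt_sum (WithTop.coe_ne_top) fun i hi => ?_
  simp only [_root_.map_mul, aeval_C, _root_.map_pow, aeval_X, u.map_mul, u.map_pow]
  refine lt_of_lt_of_le ?_ (add_le_add_left (u.zero_le_map_intCast (p.coeff i)) _)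
  rw [zero_add, ← hg, ← WithTop.coe_nsmul, WithTop.coe_lt_coe]
  exact nsmul_lt_nsmul_left_of_neg hg0 (Finset.mem_range.mp hi)

/-- For finitely many valuations, every element can be replaced by one that is integral for all of
them and a unit for exactly the same ones. -/
theorem exists_integral_of_finite {ι : Type*} [Finite ι] (u : ι → AddValuation K (WithTop G))
    (y : K) : ∃ z : K, ∀ i, 0 ≤ u i z ∧ (u i z = 0 ↔ u i y = 0) := by
  classical
  have := Fintype.ofFinite ι
  by_cases hy0 : y = 0
  · exact ⟨0, fun i => by simp [hy0]⟩
  -- `g i` is a monic integer polynomial whose value at `y` is positive for `u i`, if there is any.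
  -- The element sought is `y / f(y)` with `f = 1 + X ^ 2 * ∏ g i`.
  have hex (i : ι) : ∃ g : ℤ[X], g.Monic ∧ ((∃ q : ℤ[X], q.Monic ∧ 0 < u i (aeval y q)) →
      0 < u i (aeval y g)) := by
    by_cases h : ∃ q : ℤ[X], q.Monic ∧ 0 < u i (aeval y q)
    · obtain ⟨q, hq, hq'⟩ := h
      exact ⟨q, hq, fun _ => hq'⟩
    · exact ⟨1, monic_one, fun h' => absurd h' h⟩
  choose g hg hpos using hex
  set P : ℤ[X] := X ^ 2 * ∏ i, g i with hP
  have hPm : P.Monic := (monic_X_pow 2).mul (monic_prod_of_monic _ _ fun i _ => hg i)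
  have hPdeg : 2 ≤ P.natDegree := by
    rw [hP, (monic_X_pow 2).natDegree_mul (monic_prod_of_monic _ _ fun i _ => hg i)]
    simp
  have hdeg : (1 : ℤ[X]).degree < P.degree := by
    rw [degree_one, degree_eq_natDegree hPm.ne_zero]
    exact_mod_cast (by omega : 0 < P.natDegree)
  set f : ℤ[X] := P + 1 with hf
  have hfm : f.Monic := hPm.add_of_left hdeg
  have hfdeg : 2 ≤ f.natDegree := by
    rwa [hf, natDegree_add_eq_left_of_degree_lt hdeg]
  -- If `f(y)` had positive value, `f` itself would be a witness for `i`, so `g i`, and with it `P`,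
  -- would have positive value at `y`. But then `f(y) = P(y) + 1` has value `0`.
  have hunit (i : ι) (hi : 0 ≤ u i y) : u i (aeval y f) = 0 := by
    refine le_antisymm (not_lt.mp fun hlt => ?_) ((u i).zero_le_map_aeval hi f)
    have hgi := hpos i ⟨f, hfm, hlt⟩
    have hPi : 0 < u i (aeval y P) := by
      rw [hP, ← Finset.mul_prod_erase _ _ (Finset.mem_univ i), mul_left_comm, _root_.map_mul,
        (u i).map_mul]
      exact add_pos_of_pos_of_nonneg hgi ((u i).zero_le_map_aeval hi _)
    have : u i (aeval y f) = 0 := by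
      rw [hf, _root_.map_add, (u i).map_add_eq_of_lt_right] <;> simp [hPi]
    exact hlt.ne' this
  refine ⟨y / aeval y f, fun i => ?_⟩
  rw [(u i).map_div]
  rcases lt_or_ge (u i y) 0 with hi | hi
  -- Here `u i (y / f(y)) = (1 - deg f) • u i y`, which is positive because `deg f ≥ 2`; the factor
  -- `X ^ 2` ensures this.
  · rw [(u i).map_aeval_of_monic hi hfm]
    obtain ⟨t, ht⟩ := WithTop.ne_top_iff_exists.mp (hi.trans_le le_top).ne
    rw [← ht] at hi ⊢
    have ht0 : t < 0 := by exact_mod_cast hi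
    have : 0 < t - f.natDegree • t := by
      rw [sub_pos]
      simpa using nsmul_lt_nsmul_left_of_neg ht0 (show 1 < f.natDegree by omega)
    rw [← WithTop.coe_nsmul, ← WithTop.LinearOrderedAddCommGroup.coe_sub]
    norm_cast
    exact ⟨this.le, by constructor <;> intro h <;> order⟩
  · rw [hunit i hi, sub_zero]
    exact ⟨hi, Iff.rfl⟩

/-- Valuations on an algebra over a field which agree on the base field and can be separated from
each other are at most as many as the dimension. -/
theorem card_le_finrank_of_separated {F : Type*} [Field F] [Algebra F K] [FiniteDimensional F K]
    {ι : Type*} [Fintype ι] (u : ι → AddValuation K (WithTop G))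
    (hu : ∀ i j a, u i (algebraMap F K a) = u j (algebraMap F K a))
    (hsep : ∀ i j, i ≠ j → ∃ y, u i y = 0 ∧ 0 < u j y) :
    Fintype.card ι ≤ Module.finrank F K := by
  classical
  have hsep' (i j : ι) : ∃ z, (∀ k, 0 ≤ u k z) ∧ (i ≠ j → u i z = 0 ∧ 0 < u j z) := by
    by_cases hij : i = j
    · exact ⟨0, by simp, fun h => absurd hij h⟩
    · obtain ⟨y, h1, h2⟩ := hsep i j hij
      obtain ⟨z, hz⟩ := exists_integral_of_finite u y
      refine ⟨z, fun k => (hz k).1, fun _ => ⟨(hz i).2.mpr h1, lt_of_le_of_ne (hz j).1 ?_⟩⟩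
      exact fun h => h2.ne' ((hz j).2.mp h.symm)
  choose z hz0 hz using hsep'
  let e (i : ι) : K := ∏ j ∈ Finset.univ.erase i, z i j
  have hprod (k : ι) (s : Finset ι) (f : ι → K) : u k (∏ j ∈ s, f j) = ∑ j ∈ s, u k (f j) := by
    induction s using Finset.induction_on with
    | empty => simp
    | insert a s ha ih => rw [Finset.prod_insert ha, Finset.sum_insert ha, (u k).map_mul, ih]
  have he (i : ι) : u i (e i) = 0 := by
    rw [hprod]
    exact Finset.sum_eq_zero fun j hj => (hz i j (Finset.ne_of_mem_erase hj).symm).1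
  have he' (i j : ι) (hij : j ≠ i) : 0 < u i (e j) := by
    rw [hprod, ← Finset.add_sum_erase _ _ (Finset.mem_erase.mpr ⟨hij.symm, Finset.mem_univ i⟩)]
    exact add_pos_of_pos_of_nonneg (hz j i hij).2 (Finset.sum_nonneg fun k _ => hz0 j k i)
  refine LinearIndependent.fintype_card_le_finrank (R := F) (b := e) ?_
  rw [Fintype.linearIndependent_iff]
  intro c hc
  by_contra! hne
  obtain ⟨i₁, hi₁⟩ := hne
  -- The valuations agree on `F`, so a coefficient minimal for `u i₁` is minimal for `u i` too.
  -- Under `u i` the term `c i • e i` then has strictly the least value.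
  obtain ⟨i, -, hi⟩ := Finset.exists_min_image Finset.univ
    (fun i => u i₁ (algebraMap F K (c i))) ⟨i₁, Finset.mem_univ _⟩
  have hci : u i (algebraMap F K (c i)) ≠ ⊤ := by
    rw [hu i i₁]
    refine ((hi i₁ (Finset.mem_univ _)).trans_lt (lt_top_iff_ne_top.mpr ?_)).ne
    rw [ne_top_iff]
    simpa using hi₁
  have hterm (k j : ι) : u k (c j • e j) = u k (algebraMap F K (c j)) + u k (e j) := by
    rw [Algebra.smul_def, (u k).map_mul]
  have hlead : u i (c i • e i) = u i (algebraMap F K (c i)) := by rw [hterm, he, add_zero]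
  rw [← Finset.add_sum_erase _ _ (Finset.mem_univ i)] at hc
  have hrest : u i (c i • e i) < u i (∑ j ∈ Finset.univ.erase i, c j • e j) := by
    rw [hlead]
    refine (u i).map_lt_sum hci fun j hj => ?_
    rw [hterm]
    have hle : u i (algebraMap F K (c i)) ≤ u i (algebraMap F K (c j)) := by
      rw [hu i i₁, hu i i₁]
      exact hi j (Finset.mem_univ j)
    refine lt_of_lt_of_le ?_ (add_le_add_left hle _)
    have h0 := he' i j (Finset.ne_of_mem_erase hj)
    obtain ⟨t, ht⟩ := WithTop.ne_top_iff_exists.mp hci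
    rw [← ht]
    cases h : u i (e j) with
    | top => simp
    | coe s =>
      rw [h] at h0
      norm_cast at h0 ⊢
      simpa using h0
  have hsum := (u i).map_add_eq_of_lt_left hrest
  rw [hc, map_zero, hlead] at hsum
  exact hci hsum.symm

end AddValuation

/-! ### Valuation rings dominating a quasi-valuation -/

/-- If `w y = 0`, there is a valuation ring containing the elements of nonnegative value, whose
maximal ideal contains the elements of positive value, and in which `y` is a unit. -/
theorem IsExponentialQuasiValuation.exists_valuationSubring {E M : Type*} [Field E]
    [AddCommMonoid M] [LinearOrder M] [IsOrderedAddMonoid M] {w : E → WithTop M}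
    (hw : IsExponentialQuasiValuation w) (h1 : w 1 = 0) (hneg : ∀ x, w (-x) = w x)
    {y : E} (hy : w y = 0) :
    ∃ V : ValuationSubring E, (∀ x, 0 ≤ w x → x ∈ V) ∧ (∀ x, 0 < w x → x ∈ V.nonunits) ∧
      y ∈ V ∧ y⁻¹ ∈ V := by
  have hy0 : y ≠ 0 := by
    rintro rfl
    rw [hw.map_zero] at hy
    exact WithTop.top_ne_zero hy
  have hpow (k : ℕ) : w (y ^ k) = 0 := by
    rcases Nat.eq_zero_or_pos k with rfl | hk
    · simpa using h1
    · rw [hw.map_pow y k hk, hy, nsmul_zero]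
  have hshift (x : E) (k : ℕ) : w x ≤ w (x * y ^ k) := by
    have := hw.add_le_map_mul x (y ^ k)
    rwa [hpow, add_zero] at this
  -- This is the ring `w ≥ 0` with `y` inverted. Multiplying by powers of `y` never lowers `w`, so
  -- exponents can be raised to a common one.
  let B : Subring E :=
    { carrier := {x | ∃ k : ℕ, 0 ≤ w (x * y ^ k)}
      zero_mem' := ⟨0, by simp [hw.map_zero]⟩
      one_mem' := ⟨0, by simp [h1]⟩
      mul_mem' := by
        rintro a b ⟨k, hk⟩ ⟨l, hl⟩
        refine ⟨k + l, (add_nonneg hk hl).trans ((hw.add_le_map_mul _ _).trans_eq ?_)⟩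
        congr 1
        ring
      add_mem' := by
        rintro a b ⟨k, hk⟩ ⟨l, hl⟩
        refine ⟨k + l, (le_min (hk.trans (hshift _ l)) (hl.trans (hshift _ k))).trans
          ((hw.min_le_map_add _ _).trans_eq ?_)⟩
        congr 1
        ring
      neg_mem' := by
        rintro a ⟨k, hk⟩
        exact ⟨k, by rwa [neg_mul, hneg]⟩ }
  let I : Ideal B :=
    { carrier := {x | ∃ k : ℕ, 0 < w ((x : E) * y ^ k)}
      zero_mem' := ⟨0, by simp [hw.map_zero]⟩
      add_mem' := by
        rintro a b ⟨k, hk⟩ ⟨l, hl⟩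
        refine ⟨k + l, (lt_min (hk.trans_le (hshift _ l)) (hl.trans_le (hshift _ k))).trans_le
          ((hw.min_le_map_add _ _).trans_eq ?_)⟩
        congr 1
        push_cast
        ring
      smul_mem' := by
        rintro ⟨c, l, hl⟩ a ⟨k, hk⟩
        refine ⟨k + l, hk.trans_le ((le_add_of_nonneg_left hl).trans
          ((hw.add_le_map_mul _ _).trans_eq ?_))⟩
        congr 1
        simp only [smul_eq_mul, Subring.coe_mul]
        ring }
  -- The exponential law enters here: `w (y ^ k) = 0` is not positive.
  have hI : I ≠ ⊤ := by
    rw [Ne, Ideal.eq_top_iff_one]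
    rintro ⟨k, hk⟩
    simp [hpow] at hk
  obtain ⟨V, hBV, hIV⟩ := Ideal.image_subset_nonunits_valuationSubring I hI
  refine ⟨V, fun x hx => hBV ⟨0, by simpa using hx⟩, fun x hx => ?_,
    hBV ⟨0, by simp [hy]⟩, hBV ⟨1, by simp [hy0, h1]⟩⟩
  exact hIV ⟨⟨x, 0, by simpa using hx.le⟩, ⟨0, by simpa using hx⟩, rfl⟩

/-! ### From valuation rings to extensions of the valuation -/

section

variable {F : Type uF} {E : Type uE} {Γ : Type uΓ} [Field F] [Field E] [Algebra F E]
    [AddCommGroup Γ] [LinearOrder Γ] [IsOrderedAddMonoid Γ]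
    {v : AddValuation F (WithTop Γ)}

theorem ValuationSubring.valuation_algebraMap_le_iff {V : ValuationSubring E}
    (hV : ∀ a, algebraMap F E a ∈ V ↔ 0 ≤ v a) {a b : F} (hb : b ≠ 0) :
    V.valuation (algebraMap F E a) ≤ V.valuation (algebraMap F E b) ↔ v b ≤ v a := by
  have h0 : 0 < V.valuation (algebraMap F E b) := by simpa [zero_lt_iff] using hb
  rw [← div_le_one₀ h0, ← map_div₀, ← map_div₀, V.valuation_le_one_iff, hV, v.map_div]
  obtain ⟨γ, hγ⟩ := exists_valueGroup_eq v hb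
  rw [hγ]
  cases h : v a with
  | top => simp
  | coe s =>
    rw [← WithTop.LinearOrderedAddCommGroup.coe_sub]
    norm_cast
    exact sub_nonneg

/-- The exponential quasi-valuation given by a valuation ring lying over that of `v`. -/
theorem ExpQuasiValExt.exists_of_valuationSubring (V : ValuationSubring E)
    (hV : ∀ a, algebraMap F E a ∈ V ↔ 0 ≤ v a) :
    ∃ A : ExpQuasiValExt.{uE} E v, (∀ x y, A.w (x * y) = A.w x + A.w y) ∧
      ∀ x, 0 ≤ A.w x ↔ x ∈ V := by
  classical
  -- The value group of `V` is written multiplicatively, with smaller meaning more divisible; hence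
  -- `Additive` and the order dual.
  let f (x : E) (hx : x ≠ 0) : (Additive V.ValueGroupˣ)ᵒᵈ :=
    OrderDual.toDual (Additive.ofMul (Units.mk0 (V.valuation x) (by simpa using hx)))
  have hfle (x y : E) (hx : x ≠ 0) (hy : y ≠ 0) :
      f x hx ≤ f y hy ↔ V.valuation y ≤ V.valuation x := Iff.rfl
  have hfmul (x y : E) (hx : x ≠ 0) (hy : y ≠ 0) :
      f (x * y) (mul_ne_zero hx hy) = f x hx + f y hy := by
    have h : Units.mk0 (V.valuation (x * y)) (by simp [hx, hy]) =
        Units.mk0 (V.valuation x) (by simpa using hx) *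
          Units.mk0 (V.valuation y) (by simpa using hy) := by
      ext
      simp
    exact congrArg (fun t => OrderDual.toDual (Additive.ofMul t)) h
  let w (x : E) : WithTop (Additive V.ValueGroupˣ)ᵒᵈ := if hx : x = 0 then ⊤ else (f x hx : _)
  have hw0 : w 0 = ⊤ := dif_pos rfl
  have hw (x : E) (hx : x ≠ 0) : w x = (f x hx : WithTop _) := dif_neg hx
  have hwle (x y : E) : w x ≤ w y ↔ V.valuation y ≤ V.valuation x := by
    by_cases hy : y = 0
    · simp [hy, hw0]
    by_cases hx : x = 0
    · simp [hx, hw0, hw y hy, hy]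
    rw [hw x hx, hw y hy, WithTop.coe_le_coe, hfle x y hx hy]
  have hwmul (x y : E) : w (x * y) = w x + w y := by
    by_cases hx : x = 0
    · simp [hx, hw0]
    by_cases hy : y = 0
    · simp [hy, hw0]
    rw [hw x hx, hw y hy, hw _ (mul_ne_zero hx hy), hfmul x y hx hy, WithTop.coe_add]
  have hf1 : f 1 one_ne_zero = 0 := by
    have := hfmul 1 1 one_ne_zero one_ne_zero
    simpa using this
  have hw1 : w 1 = 0 := by rw [hw 1 one_ne_zero, hf1, WithTop.coe_zero]
  choose a ha0 ha using valueGroup.exists_map_eq (v := v)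
  have ha0' (γ : valueGroup v) : algebraMap F E (a γ) ≠ 0 := by simpa using ha0 γ
  have hle (b c : F) (hc : c ≠ 0) : w (algebraMap F E c) ≤ w (algebraMap F E b) ↔ v c ≤ v b := by
    rw [hwle, ValuationSubring.valuation_algebraMap_le_iff hV hc]
  have hval {b c : F} (hb : b ≠ 0) (hc : c ≠ 0) (h : v b = v c) :
      w (algebraMap F E b) = w (algebraMap F E c) :=
    le_antisymm ((hle _ _ hb).mpr h.le) ((hle _ _ hc).mpr h.ge)
  let incl : valueGroup v →+ (Additive V.ValueGroupˣ)ᵒᵈ :=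
    AddMonoidHom.mk' (fun γ => f (algebraMap F E (a γ)) (ha0' γ)) fun γ δ => by
      rw [← hfmul _ _ (ha0' γ) (ha0' δ), ← WithTop.coe_inj, ← hw _ (ha0' _),
        ← hw _ (mul_ne_zero (ha0' γ) (ha0' δ)), ← map_mul]
      exact hval (ha0 _) (mul_ne_zero (ha0 _) (ha0 _)) (by simp [ha])
  have hincl : StrictMono incl := by
    refine Monotone.strictMono_of_injective (fun γ δ h => ?_) fun γ δ h => ?_
    · change f _ (ha0' _) ≤ f _ (ha0' _)
      rw [← WithTop.coe_le_coe, ← hw _ (ha0' γ), ← hw _ (ha0' δ), hle _ _ (ha0 _), ha, ha]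
      exact_mod_cast h
    · replace h : f _ (ha0' γ) = f _ (ha0' δ) := h
      rw [← WithTop.coe_inj, ← hw _ (ha0' γ), ← hw _ (ha0' δ), le_antisymm_iff, hle _ _ (ha0 _),
        hle _ _ (ha0 _), ← le_antisymm_iff, ha, ha] at h
      exact_mod_cast h
  refine ⟨⟨_, incl, hincl, w, ⟨⟨hw0, fun x y => (hwmul x y).ge, fun x y => ?_⟩, fun x k hk0 => ?_⟩,
    fun b γ hb => ?_, fun b c h => by simpa using h⟩, hwmul, fun x => ?_⟩
  · rw [min_le_iff, hwle, hwle, ← le_max_iff]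
    exact V.valuation.map_add x y
  · induction k with
    | zero => exact absurd hk0 (lt_irrefl 0)
    | succ k ih =>
      rcases Nat.eq_zero_or_pos k with rfl | hk
      · simp
      · rw [pow_succ, hwmul, ih hk, succ_nsmul]
  · have hb0 : b ≠ 0 := by
      rintro rfl
      simp at hb
    exact (hval hb0 (ha0 γ) (hb.trans (ha γ).symm)).trans (hw _ (ha0' γ))
  · change 0 ≤ w x ↔ _
    rw [← hw1, hwle, map_one, V.valuation_le_one_iff]

/-- A valuation ring lying over that of `v` is the valuation ring of an extension of `v`. -/
theorem exists_mem_valuationExtensions [Algebra.IsAlgebraic F E] (V : ValuationSubring E)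
    (hV : ∀ a, algebraMap F E a ∈ V ↔ 0 ≤ v a) :
    ∃ u ∈ valuationExtensions E v, ∀ x, 0 ≤ u x ↔ x ∈ V := by
  classical
  -- The valuation of `V` has its own value group. Regarding it as an exponential quasi-valuation
  -- lets `exists_embedding` carry its values into the divisible hull.
  obtain ⟨A, hmul, hA⟩ := ExpQuasiValExt.exists_of_valuationSubring V hV
  obtain ⟨j, hj, hjk⟩ := A.exists_embedding
  choose m hm using fun (x : E) (hx : x ≠ 0) => A.exists_coe hx
  have hmj {x y : E} (hx : x ≠ 0) (hy : y ≠ 0) : j (m x hx) ≤ j (m y hy) ↔ A.w x ≤ A.w y := by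
    rw [hj.le_iff_le, hm x hx, hm y hy, WithTop.coe_le_coe, Subtype.coe_le_coe]
  let f (x : E) : WithTop (GammaDiv v) := if hx : x = 0 then ⊤ else ((j (m x hx) : GammaDiv v) : _)
  have hf0 : f 0 = ⊤ := dif_pos rfl
  have hf (x : E) (hx : x ≠ 0) : f x = ((j (m x hx) : GammaDiv v) : WithTop _) := dif_neg hx
  have hfle (x y : E) : f x ≤ f y ↔ A.w x ≤ A.w y := by
    by_cases hy : y = 0
    · simp [hy, hf0, A.isExponential.map_zero]
    by_cases hx : x = 0
    · simp [hx, hf0, hf y hy, A.isExponential.map_zero, hm y hy]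
    rw [hf x hx, hf y hy, WithTop.coe_le_coe, hmj]
  have hfm (x : E) (hx : x ≠ 0) (k : valueMonoid A.w) (h : A.w x = ((k : A.M) : WithTop A.M)) :
      f x = ((j k : GammaDiv v) : WithTop _) := by
    rw [hm x hx, WithTop.coe_inj] at h
    rw [hf x hx, Subtype.ext h]
  have hf1 : f 1 = 0 := by
    rw [hfm 1 one_ne_zero 0 (by simp [A.w_one])]
    simp
  let u : AddValuation E (WithTop (GammaDiv v)) := AddValuation.of f hf0 hf1
    (fun x y => by
      rw [min_le_iff, hfle, hfle, ← min_le_iff]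
      exact A.isExponential.min_le_map_add x y)
    (fun x y => by
      by_cases hx : x = 0
      · simp [hx, hf0]
      by_cases hy : y = 0
      · simp [hy, hf0]
      rw [hf x hx, hf y hy, ← WithTop.coe_add, ← map_add]
      refine hfm _ (mul_ne_zero hx hy) _ ?_
      rw [hmul, hm x hx, hm y hy]
      rfl)
  refine ⟨u, fun a γ ha => ?_, fun x => ?_⟩
  · have ha0 : a ≠ 0 := by
      rintro rfl
      simp at ha
    refine (hfm _ (by simpa using ha0) ⟨_, A.incl_mem_valueMonoid γ⟩
      (A.extendsAlong a γ ha)).trans ?_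
    rw [hjk _ 1 γ (by simp)]
    rfl
  · change 0 ≤ f x ↔ _
    rw [← hf1, hfle, A.w_one, hA]

theorem map_inv_mul_pow_eq_zero {A : ExpQuasiValExt.{uM} E v} {x : E}
    {m : A.M} (hm : A.w x = (m : WithTop A.M)) {k : ℕ+} {γ : valueGroup v}
    (hk : (k : ℕ) • m = A.incl γ) {a : F} (ha : v a = ((γ : Γ) : WithTop Γ)) :
    A.w (algebraMap F E a⁻¹ * x ^ (k : ℕ)) = 0 := by
  rw [A.map_algebraMap_mul, A.extendsAlong a⁻¹ (-γ) (by simp [ha]),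
    A.isExponential.map_pow x k k.pos, hm, ← WithTop.coe_nsmul, hk, ← WithTop.coe_add, ← map_add]
  simp

theorem DivisibleHull.nsmul_mk_self {G : Type*} [AddCommGroup G] [LinearOrder G]
    [IsOrderedAddMonoid G] (γ : G) (k : ℕ+) : (k : ℕ) • DivisibleHull.mk γ k = DivisibleHull.mk γ 1 := by
  rw [DivisibleHull.nsmul_mk, DivisibleHull.mk_eq_mk_iff_smul_eq_smul]
  simp

/-- The value of `a⁻¹ x ^ k` under an extension `u` of `v`. -/
theorem map_inv_mul_pow_of_mem_valuationExtensions {u : AddValuation E (WithTop (GammaDiv v))}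
    (hu : u ∈ valuationExtensions E v) {x : E} {t : GammaDiv v}
    (ht : u x = (t : WithTop (GammaDiv v))) (k : ℕ+) {γ : valueGroup v} {a : F}
    (ha : v a = ((γ : Γ) : WithTop Γ)) :
    u (algebraMap F E a⁻¹ * x ^ (k : ℕ)) =
      (((k : ℕ) • t - (k : ℕ) • DivisibleHull.mk γ k : GammaDiv v) : WithTop (GammaDiv v)) := by
  rw [u.map_mul, map_inv₀, u.map_inv, u.map_pow, ht, hu a γ ha, DivisibleHull.nsmul_mk_self,
    sub_eq_neg_add]
  rfl

/-- Through every value of an exponential quasi-valuation `w` there passes an extension of `v`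
to a valuation lying above `w`. -/
theorem ExpQuasiValExt.exists_valuation_eq [Algebra.IsAlgebraic F E] (A : ExpQuasiValExt.{uM} E v)
    {j : valueMonoid A.w →+ GammaDiv v}
    (hj : ∀ (m : valueMonoid A.w) (k : ℕ+) (γ : valueGroup v),
      (k : ℕ) • (m : A.M) = A.incl γ → j m = DivisibleHull.mk γ k)
    {x : E} {m : valueMonoid A.w} (hm : A.w x = ((m : A.M) : WithTop A.M)) :
    ∃ u ∈ valuationExtensions E v,
      (∀ (z : E) (l : valueMonoid A.w), A.w z = ((l : A.M) : WithTop A.M) →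
        ((j l : GammaDiv v) : WithTop (GammaDiv v)) ≤ u z) ∧
      u x = ((j m : GammaDiv v) : WithTop (GammaDiv v)) := by
  have hx := A.ne_zero_of_map_eq_coe hm
  obtain ⟨k, γ, hk⟩ := A.exists_nsmul_eq_incl m
  obtain ⟨a, ha0, ha⟩ := valueGroup.exists_map_eq γ
  obtain ⟨V, hV, hV', hyV, hyV'⟩ := A.isExponential.exists_valuationSubring A.w_one A.map_neg
    (map_inv_mul_pow_eq_zero hm hk ha)
  have hincl (δ : valueGroup v) : 0 ≤ A.incl δ ↔ 0 ≤ δ := by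
    rw [← A.incl_strictMono.le_iff_le, map_zero]
  have hFV (b : F) : algebraMap F E b ∈ V ↔ 0 ≤ v b := by
    by_cases hb : b = 0
    · simp [hb, V.zero_mem]
    obtain ⟨δ, hδ⟩ := exists_valueGroup_eq v hb
    refine ⟨fun h => ?_, fun h => hV _ ?_⟩
    -- If `v b < 0`, then `b⁻¹` has positive value and is a nonunit of `V`, so `b` is not in `V`.
    · by_contra! hlt
      rw [hδ] at hlt
      have hlt' : 0 < -δ := by
        rw [neg_pos]
        exact_mod_cast hlt
      have h1 := hV' (algebraMap F E b⁻¹) (by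
        rw [A.extendsAlong b⁻¹ (-δ) (by simp [hδ]), WithTop.coe_pos, ← map_zero A.incl]
        exact A.incl_strictMono hlt')
      rw [map_inv₀, V.inv_mem_nonunits_iff] at h1
      rcases h1 with h1 | h1
      · exact hb (by simpa using h1)
      · exact h1 h
    · rw [A.extendsAlong b δ hδ, WithTop.coe_nonneg, hincl]
      rw [hδ] at h
      exact_mod_cast h
  obtain ⟨u, hu, huV⟩ := exists_mem_valuationExtensions V hFV
  refine ⟨u, hu, fun z l hl => ?_, ?_⟩
  · obtain ⟨q, δ, hq⟩ := A.exists_nsmul_eq_incl l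
    obtain ⟨b, -, hb⟩ := valueGroup.exists_map_eq δ
    cases ht : u z with
    | top => exact le_top
    | coe t =>
      -- The normalised power `b⁻¹ z^q` has `w`-value `0`, so it lies in `V`; dividing its `u`-value
      -- by `q` gives the bound.
      have h := (huV _).mpr (hV _ (map_inv_mul_pow_eq_zero hl hq hb).ge)
      rw [map_inv_mul_pow_of_mem_valuationExtensions hu ht q hb, WithTop.coe_nonneg, sub_nonneg,
        nsmul_le_nsmul_iff_right q.ne_zero] at h
      rw [hj l q δ hq]
      exact_mod_cast h
  · obtain ⟨t, ht⟩ := WithTop.ne_top_iff_exists.mp (u.ne_top_iff.mpr hx)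
    have h1 := (huV _).mpr hyV
    have h2 := (huV _).mpr hyV'
    rw [u.map_inv, map_inv_mul_pow_of_mem_valuationExtensions hu ht.symm k ha] at h2
    rw [map_inv_mul_pow_of_mem_valuationExtensions hu ht.symm k ha, WithTop.coe_nonneg] at h1
    rw [← WithTop.LinearOrderedAddCommGroup.coe_neg, WithTop.coe_nonneg, neg_nonneg] at h2
    -- Both `y` and `y⁻¹` lie in `V`, so `u(y) = 0`, that is, `k u(x) = γ`.
    have h3 := sub_eq_zero.mp (le_antisymm h2 h1)
    rw [← ht, hj m k γ hk, nsmul_right_injective k.ne_zero h3]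

/-! ### The number of extensions -/

/-- There are at most `[E : F]` extensions of `v`. -/
theorem card_le_finrank_of_subset_valuationExtensions [FiniteDimensional F E]
    {s : Finset (AddValuation E (WithTop (GammaDiv v)))}
    (hs : (s : Set _) ⊆ valuationExtensions E v) : s.card ≤ Module.finrank F E := by
  -- For `u(x) = γ/k` and `γ = v(a)`, the element `a⁻¹ x^k` turns `u(x) < u'(x)` into a comparison
  -- with `0`.
  have hlt {u u' : AddValuation E (WithTop (GammaDiv v))} (hu : u ∈ valuationExtensions E v)
      (hu' : u' ∈ valuationExtensions E v) {x : E} (h : u x < u' x) : ∃ y, u y = 0 ∧ 0 < u' y := by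
    obtain ⟨t, ht⟩ := WithTop.ne_top_iff_exists.mp (h.trans_le le_top).ne
    rw [← ht] at h
    induction t using DivisibleHull.ind with
    | mk γ k =>
      obtain ⟨a, ha0, ha⟩ := valueGroup.exists_map_eq γ
      by_cases hx : x = 0
      · simp [hx] at ht
      obtain ⟨t', ht'⟩ := WithTop.ne_top_iff_exists.mp (u'.ne_top_iff.mpr hx)
      refine ⟨algebraMap F E a⁻¹ * x ^ (k : ℕ), ?_, ?_⟩
      · rw [map_inv_mul_pow_of_mem_valuationExtensions hu ht.symm k ha, sub_self, WithTop.coe_zero]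
      · rw [map_inv_mul_pow_of_mem_valuationExtensions hu' ht'.symm k ha, WithTop.coe_pos, sub_pos]
        refine nsmul_lt_nsmul_right k.ne_zero ?_
        rw [← ht'] at h
        exact_mod_cast h
  rw [← Fintype.card_coe]
  refine AddValuation.card_le_finrank_of_separated (F := F) (fun u : s => u.1)
    (fun i i' a => ?_) fun i i' hne => ?_
  · by_cases ha : a = 0
    · simp [ha]
    obtain ⟨γ, hγ⟩ := exists_valueGroup_eq v ha
    rw [hs i.2 a γ hγ, hs i'.2 a γ hγ]
  · obtain ⟨x, hx⟩ : ∃ x, i.1 x ≠ i'.1 x := by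
      by_contra! h
      exact hne (Subtype.ext (AddValuation.ext h))
    rcases hx.lt_or_gt with h | h
    · exact hlt (hs i.2) (hs i'.2) h
    -- Inversion reverses the inequality.
    · refine hlt (hs i.2) (hs i'.2) (x := x⁻¹) ?_
      have hx0 : x ≠ 0 := by
        rintro rfl
        simp at hx
      obtain ⟨t, ht⟩ := WithTop.ne_top_iff_exists.mp (i.1.ne_top_iff.mpr hx0)
      obtain ⟨t', ht'⟩ := WithTop.ne_top_iff_exists.mp (i'.1.ne_top_iff.mpr hx0)
      rw [← ht, ← ht', WithTop.coe_lt_coe] at h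
      rw [AddValuation.map_inv, AddValuation.map_inv, ← ht, ← ht',
        ← WithTop.LinearOrderedAddCommGroup.coe_neg, ← WithTop.LinearOrderedAddCommGroup.coe_neg,
        WithTop.coe_lt_coe]
      exact neg_lt_neg h

end

/-! ### Quasi-valuations as minima, and the count -/

section

variable {F : Type uF} {E : Type uE} {Γ : Type uΓ} [Field F] [Field E] [Algebra F E]
    [AddCommGroup Γ] [LinearOrder Γ] [IsOrderedAddMonoid Γ]
    {v : AddValuation F (WithTop Γ)}

namespace ExpQuasiValExt

theorem exists_isMinOf [Algebra.IsAlgebraic F E] (A : ExpQuasiValExt.{uM} E v) :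
    ∃ S : Set (AddValuation E (WithTop (GammaDiv v))),
      S.Nonempty ∧ S ⊆ valuationExtensions E v ∧ A.IsMinOf S := by
  obtain ⟨j, hj, hjk⟩ := A.exists_embedding
  -- The set consists of all extensions lying above `w`; the minimum is attained at each `x` by
  -- `exists_valuation_eq`.
  refine ⟨{u ∈ valuationExtensions E v | ∀ (z : E) (l : valueMonoid A.w),
    A.w z = ((l : A.M) : WithTop A.M) → ((j l : GammaDiv v) : WithTop (GammaDiv v)) ≤ u z},
    ?_, fun u hu => hu.1, j, hj, fun γ m hm => ?_, fun x m hm => ⟨?_, ?_⟩⟩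
  · obtain ⟨u, hu, hle, -⟩ := A.exists_valuation_eq hjk (x := 1) (m := 0) (by simp [A.w_one])
    exact ⟨u, hu, hle⟩
  · rw [hjk m 1 γ (by simpa using hm)]
    rfl
  · obtain ⟨u, hu, hle, h⟩ := A.exists_valuation_eq hjk hm
    exact ⟨u, ⟨hu, hle⟩, h⟩
  · rintro _ ⟨u, hu, rfl⟩
    exact hu.2 x m hm

theorem IsMinOf.of_iso {A B : ExpQuasiValExt.{uM} E v}
    {S : Set (AddValuation E (WithTop (GammaDiv v)))} (hS : A.IsMinOf S) (h : A.Iso B) :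
    B.IsMinOf S := by
  obtain ⟨j, hj, hjγ, hmin⟩ := hS
  obtain ⟨e, he⟩ := h
  have hw (x : E) (m : valueMonoid B.w) (hm : B.w x = ((m : B.M) : WithTop B.M)) :
      A.w x = ((e.symm m : A.M) : WithTop A.M) := by
    obtain ⟨k, hk⟩ := A.exists_coe (B.ne_zero_of_map_eq_coe hm)
    have h := he x k hk
    rw [hm, WithTop.coe_inj] at h
    rw [hk, Subtype.ext h]
    simp
  refine ⟨j.comp (e.symm : valueMonoid B.w →+ valueMonoid A.w), ?_, fun γ m hm => ?_,
    fun x m hm => hmin x _ (hw x m hm)⟩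
  · exact fun a b hab => hj (e.symm.strictMono hab)
  · obtain ⟨a, -, ha⟩ := valueGroup.exists_map_eq γ
    have h1 := hw (algebraMap F E a) m (by rw [hm, B.extendsAlong a γ ha])
    rw [A.extendsAlong a γ ha, WithTop.coe_inj] at h1
    exact hjγ γ (e.symm m) h1.symm

/-- The minima over `S` generate the images of both value monoids in the divisible hull. The images
therefore coincide, and `e` is the first embedding followed by the inverse of the second. -/
theorem IsMinOf.iso {A B : ExpQuasiValExt.{uM} E v}
    {S : Set (AddValuation E (WithTop (GammaDiv v)))} (hA : A.IsMinOf S) (hB : B.IsMinOf S) :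
    A.Iso B := by
  obtain ⟨j, hj, -, hmin⟩ := hA
  obtain ⟨j', hj', -, hmin'⟩ := hB
  have heq {x : E} {m : valueMonoid A.w} {m' : valueMonoid B.w}
      (hm : A.w x = ((m : A.M) : WithTop A.M)) (hm' : B.w x = ((m' : B.M) : WithTop B.M)) :
      j' m' = j m :=
    WithTop.coe_inj.mp ((hmin' x m' hm').unique (hmin x m hm))
  have hf (m : valueMonoid A.w) : ∃ m' : valueMonoid B.w, j' m' = j m := by
    obtain ⟨m, hm⟩ := m
    induction hm using AddSubmonoid.closure_induction with
    | mem m h =>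
      obtain ⟨x, hx, hxm⟩ := h
      obtain ⟨m', hm'⟩ := B.exists_coe hx
      exact ⟨m', heq (m := ⟨m, AddSubmonoid.subset_closure ⟨x, hx, hxm⟩⟩) hxm hm'⟩
    | zero => exact ⟨0, (map_zero j').trans (map_zero j).symm⟩
    | add a b ha hb iha ihb =>
      obtain ⟨a', ha'⟩ := iha
      obtain ⟨b', hb'⟩ := ihb
      exact ⟨a' + b', by rw [map_add, ha', hb', ← map_add]; rfl⟩
  have hg (m : valueMonoid B.w) : ∃ m' : valueMonoid A.w, j m' = j' m := by
    obtain ⟨m, hm⟩ := m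
    induction hm using AddSubmonoid.closure_induction with
    | mem m h =>
      obtain ⟨x, hx, hxm⟩ := h
      obtain ⟨m', hm'⟩ := A.exists_coe hx
      exact ⟨m', (heq (m' := ⟨m, AddSubmonoid.subset_closure ⟨x, hx, hxm⟩⟩) hm' hxm).symm⟩
    | zero => exact ⟨0, (map_zero j).trans (map_zero j').symm⟩
    | add a b ha hb iha ihb =>
      obtain ⟨a', ha'⟩ := iha
      obtain ⟨b', hb'⟩ := ihb
      exact ⟨a' + b', by rw [map_add, ha', hb', ← map_add]; rfl⟩
  choose f hf using hf
  choose g hg using hg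
  let e : valueMonoid A.w ≃+o valueMonoid B.w :=
    { toFun := f
      invFun := g
      left_inv := fun m => hj.injective (by rw [hg, hf])
      right_inv := fun m => hj'.injective (by rw [hf, hg])
      map_add' := fun a b => hj'.injective (by rw [hf, map_add, map_add, hf, hf])
      map_le_map_iff' := fun {a b} => by
        change f a ≤ f b ↔ a ≤ b
        rw [← hj'.le_iff_le, hf, hf, hj.le_iff_le] }
  refine ⟨e, fun x m hm => ?_⟩
  obtain ⟨m', hm'⟩ := B.exists_coe (A.ne_zero_of_map_eq_coe hm)
  have : e m = m' := hj'.injective ((hf m).trans (heq hm hm').symm)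
  rw [hm', this]

end ExpQuasiValExt

theorem sum_choose_Icc_one (n : ℕ) : ∑ i ∈ Finset.Icc 1 n, n.choose i = 2 ^ n - 1 := by
  have h := Nat.sum_range_choose n
  rw [Finset.sum_range_succ', Nat.choose_zero_right] at h
  rw [← h, Nat.add_sub_cancel, ← Finset.Ico_succ_right_eq_Icc, Finset.sum_Ico_eq_sum_range]
  simp [add_comm]

theorem card_le_of_injective_nonempty_subsets {α β : Type*} {s : Set β} {n : ℕ} (hs : s.Finite)
    (hn : s.ncard ≤ n) {f : α → Set β} (hf : Function.Injective f)
    (hfs : ∀ a, (f a).Nonempty ∧ f a ⊆ s) : Finite α ∧ Nat.card α ≤ 2 ^ n - 1 := by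
  have hfin : (s.powerset \ {∅}).Finite := hs.powerset.subset Set.sdiff_subset
  have : Finite ↑(s.powerset \ {∅}) := hfin
  let g : α → ↑(s.powerset \ {∅}) := fun a => ⟨f a, (hfs a).2, (hfs a).1.ne_empty⟩
  have hg : Function.Injective g := fun a b h => hf (congrArg Subtype.val h)
  refine ⟨Finite.of_injective g hg, (Nat.card_le_card_of_injective g hg).trans ?_⟩
  rw [Nat.card_coe_set_eq, Set.ncard_sdiff_singleton_of_mem (Set.empty_subset s),
    Set.ncard_powerset s hs]
  exact Nat.sub_le_sub_right (Nat.pow_le_pow_right two_pos hn) 1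

end

theorem corollary7p9 {F : Type uF} {E : Type uE} {Γ : Type uΓ}
    [Field F] [Field E] [Algebra F E] [FiniteDimensional F E]
    [AddCommGroup Γ] [LinearOrder Γ] [IsOrderedAddMonoid Γ]
    (v : AddValuation F (WithTop Γ)) (n : ℕ) (hn : n = Module.finrank F E) :
    -- there are at most `n` extensions of `v` to a valuation on `E`
    ((valuationExtensions E v).Finite ∧ (valuationExtensions E v).ncard ≤ n) ∧
    -- each exponential quasi-valuation is the minimum of the nonempty set of extensions of `v`
    -- that corresponds to it, and distinct ones correspond to distinct sets
    (∃ Φ : Quotient (ExpQuasiValExt.setoid.{uM} E v) →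
        Set (AddValuation E (WithTop (GammaDiv v))),
      Function.Injective Φ ∧
      ∀ A : ExpQuasiValExt.{uM} E v,
        (Φ (Quotient.mk _ A)).Nonempty ∧ Φ (Quotient.mk _ A) ⊆ valuationExtensions E v ∧
          A.IsMinOf (Φ (Quotient.mk _ A))) ∧
    -- the number of exponential quasi-valuations extending `v`
    Finite (Quotient (ExpQuasiValExt.setoid.{uM} E v)) ∧
    Nat.card (Quotient (ExpQuasiValExt.setoid.{uM} E v)) ≤ ∑ i ∈ Finset.Icc 1 n, n.choose i ∧
    ∑ i ∈ Finset.Icc 1 n, n.choose i = 2 ^ n - 1 := by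
  have hcard (s : Finset (AddValuation E (WithTop (GammaDiv v))))
      (hs : (s : Set _) ⊆ valuationExtensions E v) : s.card ≤ n :=
    hn ▸ card_le_finrank_of_subset_valuationExtensions hs
  have hfin : (valuationExtensions E v).Finite := by
    by_contra hinf
    obtain ⟨s, hs, hsn⟩ := Set.Infinite.exists_subset_card_eq hinf (n + 1)
    have := hcard s hs
    omega
  have hncard : (valuationExtensions E v).ncard ≤ n := by
    rw [Set.ncard_eq_toFinset_card _ hfin]
    exact hcard _ (by simp)
  -- A set is chosen for one representative of each class; `IsMinOf.of_iso` transfers it to the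
  -- others.
  choose S hne hsub hmin using fun q : Quotient (ExpQuasiValExt.setoid.{uM} E v) =>
    q.out.exists_isMinOf
  have hmin' (A : ExpQuasiValExt.{uM} E v) : A.IsMinOf (S (Quotient.mk _ A)) :=
    (hmin _).of_iso (Quotient.mk_out (s := ExpQuasiValExt.setoid.{uM} E v) A)
  have hinj : Function.Injective S := by
    intro q q' h
    induction q using Quotient.ind with | _ A
    induction q' using Quotient.ind with | _ B
    exact Quotient.sound ((hmin' A).iso (h ▸ hmin' B))
  obtain ⟨h1, h2⟩ := card_le_of_injective_nonempty_subsets hfin hncard hinj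
    fun q => ⟨hne q, hsub q⟩
  exact ⟨⟨hfin, hncard⟩, ⟨S, hinj, fun A => ⟨hne _, hsub _, hmin' A⟩⟩, h1,
    (sum_choose_Icc_one n).symm ▸ h2, sum_choose_Icc_one n⟩
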